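/- All graphs have a finite vertex set. For a DAG $\mathcal G$, a causal path from $X$ to $Y\neq X$ is a directed path from $X$ to $Y$, and $X$ is a cause of $Y$ in $\mathcal G$ if there is such a path. Two DAGs on the same vertex set are Markov equivalent if they have the same d-separation relations. A CPDAG $\mathcal G^*$ is the partially directed graph that represents a Markov equivalence class $[\mathcal G^*]$ of DAGs: it has the same adjacencies as the DAGs of the class, an edge of it is directed, $a\to b$, if and only if $a\to b$ occurs in every DAG of the class, and its other edges are undirected. The chain components of $\mathcal G^*$ are the connected components of its undirected subgraph (single vertices included). $X$ is a definite cause of $Y$ if it is a cause of $Y$ in every DAG in $[\mathcal G^*]$, a definite non-cause if it is a cause of $Y$ in none of them, and a possible cause if it is neither. $X$ is an explicit cause of $Y$ if one and the same path is a causal path from $X$ to $Y$ in every DAG in $[\mathcal G^*]$, and an implicit cause of $Y$ if it is a definite cause but not an explicit cause of $Y$. Let $\mathcal G^*$ be a CPDAG. (i) Let $X$ and $Y$ be two vertices of $\mathcal G^*$ in different chain components. If $X$ is the only explicit cause of $Y$ in the chain component to which $X$ belongs, then every vertex of this chain component, except $X$, is a possible cause of $Y$. (ii) If a vertex $W$ is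 an implicit cause of a vertex $Y$, then the chain component of $W$ contains at least two distinct explicit causes of $Y$. -/

import Mathlib

namespace CausalGraph

universe u

variable {V : Type u}

/-- A directed acyclic graph on the vertex set `V`. -/
structure DAG (V : Type u) extends Digraph V where
  /-- There are no directed cycles (in particular no loops and no antiparallel edges). -/
  acyclic : ∀ v, ¬ Relation.TransGen Adj v v

namespace DAG

/-- `G.Edge a b`: the directed edge `a → b` occurs in `G`. -/
def Edge (G : DAG V) (a b : V) : Prop := G.toDigraph.Adj a b

/-- Adjacency in the skeleton of `G`. -/
def Adjacent (G : DAG V) (a b : V) : Prop := G.Edge a b ∨ G.Edge b a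

/-- `x` is an ancestor of `y` (and `y` a descendant of `x`); every vertex is an ancestor of
itself. -/
def IsAncestor (G : DAG V) (x y : V) : Prop := Relation.ReflTransGen G.Edge x y

/-- `x` is a cause of `y` in `G`: `x` is an ancestor of `y` different from `y`. -/
def IsCause (G : DAG V) (x y : V) : Prop := G.IsAncestor x y ∧ x ≠ y

/-- The list `p` of pairwise distinct vertices is a path from `x` to `y` in `G`: consecutive
vertices are adjacent. -/
def IsPath (G : DAG V) (x y : V) (p : List V) : Prop :=
  p.Nodup ∧ p.IsChain G.Adjacent ∧ p.head? = some x ∧ p.getLast? = some y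

/-- The list `p` of pairwise distinct vertices is a directed path from `x` to `y` in `G`. -/
def IsDirectedPath (G : DAG V) (x y : V) (p : List V) : Prop :=
  p.Nodup ∧ p.IsChain G.Edge ∧ p.head? = some x ∧ p.getLast? = some y

/-- A causal path from `x` to `y` is a directed path between two distinct vertices. -/
def IsCausalPath (G : DAG V) (x y : V) (p : List V) : Prop :=
  x ≠ y ∧ G.IsDirectedPath x y p

/-- `v` is a collider on the path `p`: an intermediate vertex with both neighbouring edges on the
path pointing at it. -/
def IsCollider (G : DAG V) (p : List V) (v : V) : Prop :=
  ∃ a b, [a, v, b] <:+: p ∧ G.Edge a v ∧ G.Edge b v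

/-- `v` is a non-collider on the path `p`: an intermediate vertex that is not a collider. -/
def IsNonCollider (G : DAG V) (p : List V) (v : V) : Prop :=
  (∃ a b, [a, v, b] <:+: p) ∧ ¬ G.IsCollider p v

/-- The path `p` from `x` to `y` is active (d-connected) given `C`: `C` contains no endpoint and no
non-collider of `p`, and every collider on `p` has a descendant in `C`. -/
def IsActive (G : DAG V) (C : Set V) (x y : V) (p : List V) : Prop :=
  x ∉ C ∧ y ∉ C ∧ (∀ v, G.IsNonCollider p v → v ∉ C) ∧
    ∀ v, G.IsCollider p v → ∃ d ∈ C, G.IsAncestor v d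

/-- `A` and `B` are d-separated by `C` in `G`: every path between them is blocked. -/
def DSep (G : DAG V) (A B C : Set V) : Prop :=
  ∀ x ∈ A, ∀ y ∈ B, ∀ p, G.IsPath x y p → ¬ G.IsActive C x y p

/-- The set of d-separation relations read off from `G`, over pairwise disjoint vertex sets. -/
def dsepRelations (G : DAG V) : Set (Set V × Set V × Set V) :=
  {t | Disjoint t.1 t.2.1 ∧ Disjoint t.1 t.2.2 ∧ Disjoint t.2.1 t.2.2 ∧
    G.DSep t.1 t.2.1 t.2.2}

/-- Markov equivalence: the same d-separation relations. -/
def MarkovEquiv (G H : DAG V) : Prop := G.dsepRelations = H.dsepRelations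

end DAG

/-- A graph on `V` with directed and undirected edges, at most one edge between two vertices and no
loops. -/
structure PDGraph (V : Type u) where
  /-- the directed subgraph -/
  directed : Digraph V
  /-- the undirected subgraph -/
  undirected : SimpleGraph V
  directed_asymm : ∀ a b, directed.Adj a b → ¬ directed.Adj b a
  not_both : ∀ a b, undirected.Adj a b → ¬ directed.Adj a b

namespace PDGraph

/-- Two vertices are adjacent if some edge, directed or undirected, joins them. -/
def Adjacent (S : PDGraph V) (a b : V) : Prop :=
  S.directed.Adj a b ∨ S.directed.Adj b a ∨ S.undirected.Adj a b

/-- `S` represents the Markov equivalence class of `G`: it has the adjacencies of `G`, and its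
directed edges are those that occur in every DAG that is Markov equivalent to `G`. -/
def Represents (S : PDGraph V) (G : DAG V) : Prop :=
  (∀ a b, S.Adjacent a b ↔ G.Adjacent a b) ∧
    ∀ a b, S.directed.Adj a b ↔ ∀ H : DAG V, G.MarkovEquiv H → H.Edge a b

/-- `S` is a CPDAG: it represents the Markov equivalence class of some DAG. -/
def IsCPDAG (S : PDGraph V) : Prop := ∃ G : DAG V, S.Represents G

/-- The Markov equivalence class represented by the CPDAG `S`. -/
def equivClass (S : PDGraph V) : Set (DAG V) := {G | S.Represents G}

/-- `x` and `y` lie in the same chain component, that is, in the same connected component of the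
undirected subgraph. -/
def SameChainComponent (S : PDGraph V) (x y : V) : Prop := S.undirected.Reachable x y

/-- `x` is a cause of `y` in every DAG of the class. -/
def IsDefiniteCause (S : PDGraph V) (x y : V) : Prop := ∀ G ∈ S.equivClass, G.IsCause x y

/-- `x` is a cause of `y` in no DAG of the class. -/
def IsDefiniteNonCause (S : PDGraph V) (x y : V) : Prop := ∀ G ∈ S.equivClass, ¬ G.IsCause x y

/-- `x` is neither a definite cause nor a definite non-cause of `y`. -/
def IsPossibleCause (S : PDGraph V) (x y : V) : Prop :=
  ¬ S.IsDefiniteCause x y ∧ ¬ S.IsDefiniteNonCause x y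

/-- One and the same path is a causal path from `x` to `y` in every DAG of the class. -/
def IsExplicitCause (S : PDGraph V) (x y : V) : Prop :=
  ∃ p : List V, ∀ G ∈ S.equivClass, G.IsCausalPath x y p

/-- `x` is a definite cause of `y`, but no path is a causal path from `x` to `y` in every DAG of
the class. -/
def IsImplicitCause (S : PDGraph V) (x y : V) : Prop :=
  S.IsDefiniteCause x y ∧ ¬ ∃ p : List V, ∀ G ∈ S.equivClass, G.IsCausalPath x y p

end PDGraph

end CausalGraph

/-! If `a → b` is directed in the CPDAG and `b — c` is undirected, then `a → c` is directed
(`Compelled.trans_free`). So on a directed path of a member DAG from `z` to a vertex `y` of another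
chain component, the undirected edges after the first directed one can be absorbed: some `c` in the
component of `z`, reached from `z`, has a path of directed CPDAG edges to `y`
(`Represents.exists_isExplicitCause`). Moreover each vertex `x` is the root of its component in some
member (`Represents.exists_root`): there it is an ancestor of the whole component, and no other
vertex of the component is an ancestor of `x`.

For (i), root at `x`: `z` could reach `y` only through the explicit cause `x`, which it does not
reach. Root at `z`: `z` reaches `x`, hence `y`. For (ii), rooting at `y` shows that `w` is outside
the component of `y`, so its component contains an explicit cause; this is not `w`, and if it were
the only one, (i) would contradict definiteness.

Rooted members exist because Markov equivalence amounts to equal skeletons and v-structures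
(`SamePattern.markovEquiv`), the directed edges are the closure of the v-structures under Meek's
rules (`compelled_iff`), and the other edges have a perfect elimination ordering ending at any given
vertex (`exists_perfect_ranking`). -/

namespace CausalGraph

universe u

variable {V : Type u}

/-! ### Active paths, open walks and reachability -/

namespace DAG

variable {G H : DAG V} {C : Set V}

theorem Edge.asymm {a b : V} (h : G.Edge a b) : ¬ G.Edge b a := fun h' =>
  G.acyclic a (.tail (.single h) h')

theorem Edge.ne {a b : V} (h : G.Edge a b) : a ≠ b := by
  rintro rfl
  exact h.asymm h

theorem Adjacent.symm {a b : V} (h : G.Adjacent a b) : G.Adjacent b a := Or.symm h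

theorem edge_of_trans {a b c : V} (h₁ : G.Edge a b) (h₂ : G.Edge b c) (h : G.Adjacent a c) :
    G.Edge a c :=
  h.resolve_right fun h₃ => G.acyclic a (.tail (.tail (.single h₁) h₂) h₃)

/-- A walk that leaves `u` along an outgoing edge is directed or meets a collider below `u`. -/
theorem transGen_or_exists_collider {u q y : V} {l : List V}
    (hc : (u :: q :: l).IsChain G.Adjacent) (hu : G.Edge u q)
    (hy : (u :: q :: l).getLast? = some y) :
    Relation.TransGen G.Edge u y ∨
      ∃ a v b, [a, v, b] <:+: u :: q :: l ∧ G.Edge a v ∧ G.Edge b v ∧ G.IsAncestor u v := by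
  induction l generalizing u q with
  | nil =>
    simp at hy
    exact Or.inl (hy ▸ .single hu)
  | cons w l ih =>
    simp only [List.isChain_cons_cons] at hc
    rcases hc.2.1 with h | h
    · rcases ih (List.isChain_cons_cons.2 hc.2) h (by simpa using hy) with h' | ⟨a, v, b, h₁, h₂, h₃, h₄⟩
      · exact Or.inl (.head hu h')
      · exact Or.inr ⟨a, v, b, h₁.trans (List.suffix_cons _ _).isInfix, h₂, h₃, .head hu h₄⟩
    · exact Or.inr ⟨u, q, w, ⟨[], l, rfl⟩, hu, h, .single hu⟩

/-- The condition that a triple of consecutive vertices does not block a walk given `C`. -/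
def OpenTriple (G : DAG V) (C : Set V) (a v b : V) : Prop :=
  (G.Edge a v → G.Edge b v → ∃ d ∈ C, G.IsAncestor v d) ∧
    (¬ (G.Edge a v ∧ G.Edge b v) → v ∉ C)

theorem OpenTriple.symm {a v b : V} (h : G.OpenTriple C a v b) : G.OpenTriple C b v a :=
  ⟨fun h₁ h₂ => h.1 h₂ h₁, fun h' => h.2 fun h'' => h' h''.symm⟩

/-- A walk, possibly with repeated vertices, all of whose consecutive triples are open. -/
def IsOpenWalk (G : DAG V) (C : Set V) (x y : V) (w : List V) : Prop :=
  w.IsChain G.Adjacent ∧ w.head? = some x ∧ w.getLast? = some y ∧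
    ∀ a v b, [a, v, b] <:+: w → G.OpenTriple C a v b

theorem IsOpenWalk.reverse {x y : V} {w : List V} (h : G.IsOpenWalk C x y w) :
    G.IsOpenWalk C y x w.reverse := by
  obtain ⟨h₁, h₂, h₃, h₄⟩ := h
  refine ⟨List.isChain_reverse.2 (h₁.imp fun _ _ h => h.symm), by simpa, by simpa, ?_⟩
  intro a v b h
  refine (h₄ b v a ?_).symm
  rw [← List.reverse_infix]
  simpa using h

theorem infix_append_cons {a m b v : V} {A D : List V} (h : [a, m, b] <:+: A ++ v :: D) :
    [a, m, b] <:+: A ++ [v] ∨ [a, m, b] <:+: v :: D ∨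
      m = v ∧ [a] <:+ A ∧ [b] <+: D := by
  induction A with
  | nil => exact Or.inr (Or.inl h)
  | cons c A ih =>
    rcases List.infix_cons_iff.1 h with h | h
    · match A with
      | [] =>
        match D with
        | [] => simp at h
        | d :: D =>
          simp at h
          obtain ⟨rfl, rfl, rfl⟩ := h
          simp
      | [e] =>
        simp at h
        obtain ⟨rfl, rfl, rfl⟩ := h
        simp
      | e :: f :: A =>
        simp at h
        obtain ⟨rfl, rfl, rfl⟩ := h
        exact Or.inl ⟨[], A ++ [v], by simp⟩
    · rcases ih h with h | h | ⟨h₁, h₂, h₃⟩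
      · exact Or.inl (h.trans (List.suffix_cons _ _).isInfix)
      · exact Or.inr (Or.inl h)
      · exact Or.inr (Or.inr ⟨h₁, h₂.trans (List.suffix_cons _ _), h₃⟩)

theorem IsOpenWalk.cut {x y v : V} {A B D : List V}
    (h : G.IsOpenWalk C x y (A ++ v :: (B ++ v :: D))) : G.IsOpenWalk C x y (A ++ v :: D) := by
  obtain ⟨h₁, h₂, h₃, h₄⟩ := h
  have hA : A ++ [v] <:+: A ++ v :: (B ++ v :: D) := ⟨[], B ++ v :: D, by simp⟩
  have hB : v :: (B ++ [v]) <:+: A ++ v :: (B ++ v :: D) := ⟨A, D, by simp⟩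
  have hD : v :: D <:+: A ++ v :: (B ++ v :: D) := ⟨A ++ v :: B, [], by simp⟩
  refine ⟨?_, ?_, ?_, ?_⟩
  · have e₁ := h₁.infix hA
    have e₂ := h₁.infix hD
    rw [List.isChain_append] at e₁ ⊢
    exact ⟨e₁.1, e₂, by simpa using e₁.2.2⟩
  · cases A <;> simpa using h₂
  · simpa [List.getLast?_append, List.getLast?_cons] using h₃
  · intro a m b h
    rcases infix_append_cons h with h | h | ⟨rfl, ⟨A', rfl⟩, ⟨D', rfl⟩⟩
    · exact h₄ _ _ _ (h.trans hA)
    · exact h₄ _ _ _ (h.trans hD)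
    · obtain ⟨q, R, hq⟩ : ∃ q R, B ++ [m] = q :: R := by cases B <;> simp
      obtain ⟨R', z, hz⟩ : ∃ R' z, m :: B = R' ++ [z] :=
        ⟨_, _, (List.dropLast_append_getLast (List.cons_ne_nil m B)).symm⟩
      have t₁ : G.OpenTriple C a m q := h₄ _ _ _ ⟨A', R ++ b :: D', by
        have : B ++ m :: (b :: D') = (B ++ [m]) ++ b :: D' := by simp
        simp [this, hq]⟩
      have t₂ : G.OpenTriple C z m b := h₄ _ _ _ ⟨A' ++ [a] ++ R', D', by
        have : m :: (B ++ m :: (b :: D')) = (m :: B) ++ m :: (b :: D') := by simp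
        simp [this, hz]⟩
      -- Only the triple at the junction is new. If it is a collider and the removed loop leaves `m`
      -- by `m → q`, the loop cannot be directed, so it meets an open collider below `m`. If it is
      -- not, an edge leaving `m` already made an old triple a non-collider.
      refine ⟨fun e₁ e₂ => ?_, fun hn => ?_⟩
      · by_cases hqm : G.Edge q m
        · exact t₁.1 e₁ hqm
        · rw [hq] at hB
          have hch := h₁.infix hB
          have hmq := (List.isChain_cons_cons.1 hch).1.resolve_right hqm
          have hl : (m :: q :: R).getLast? = some m := by
            rw [← hq, ← List.cons_append, List.getLast?_concat]
          rcases transGen_or_exists_collider hch hmq hl with hh | ⟨a', v', b', i₁, i₂, i₃, i₄⟩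
          · exact (G.acyclic _ hh).elim
          · obtain ⟨d, hd, hd'⟩ := (h₄ _ _ _ (i₁.trans hB)).1 i₂ i₃
            exact ⟨d, hd, i₄.trans hd'⟩
      · by_cases ha : G.Edge a m
        · exact t₂.2 fun hh => hn ⟨ha, hh.2⟩
        · exact t₁.2 fun hh => ha hh.1

theorem IsOpenWalk.exists_nodup {x y : V} {w : List V} (h : G.IsOpenWalk C x y w) :
    ∃ p, p.Nodup ∧ G.IsOpenWalk C x y p := by
  induction hn : w.length using Nat.strong_induction_on generalizing w with
  | _ n ih =>
    by_cases hw : w.Nodup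
    · exact ⟨w, hw, h⟩
    · obtain ⟨v, hv⟩ : ∃ v, List.Duplicate v w := by
        simpa [List.nodup_iff_forall_not_duplicate] using hw
      have : ∃ A B D, w = A ++ v :: (B ++ v :: D) := by
        clear ih hn h hw
        induction hv with
        | cons_mem hm =>
          obtain ⟨B, D, rfl⟩ := List.append_of_mem hm
          exact ⟨[], B, D, rfl⟩
        | cons_duplicate _ ih =>
          obtain ⟨A, B, D, rfl⟩ := ih
          exact ⟨_ :: A, B, D, rfl⟩
      obtain ⟨A, B, D, rfl⟩ := this
      exact ih _ (by simp [← hn]) h.cut rfl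

theorem triple_unique {a v b a' b' : V} {p : List V} (hp : p.Nodup) (h : [a, v, b] <:+: p)
    (h' : [a', v, b'] <:+: p) : a = a' ∧ b = b' := by
  obtain ⟨s, t, rfl⟩ := h
  obtain ⟨s', t', h'⟩ := h'
  have e : (s' ++ [a']) ++ v :: (b' :: t') = (s ++ [a]) ++ v :: (b :: t) := by simpa using h'
  have hp' : ((s ++ [a]) ++ v :: (b :: t)).Nodup := by simpa using hp
  have h₁ : v ∉ s ++ [a] := fun hm => (List.nodup_append.1 hp').2.2 v hm v (by simp) rfl
  have h₂ : v ∉ b :: t := (List.nodup_cons.1 (List.nodup_append.1 hp').2.1).1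
  obtain ⟨i, -, k⟩ := (List.append_cons_inj_of_notMem h₁ h₂).1 e.symm
  simp at i k
  exact ⟨i.2, k.1⟩

/-- `v` is reachable from `x` along an open walk given `C` on which every collider lies in `C`;
the last edge points at `v` exactly if the flag is `true`. -/
inductive Reach (G : DAG V) (C : Set V) (x : V) : V → Bool → Prop
  | start : Reach G C x x false
  | down {v c : V} {d : Bool} : Reach G C x v d → v ∉ C → G.Edge v c → Reach G C x c true
  | up {v p : V} : Reach G C x v false → v ∉ C → G.Edge p v → Reach G C x p false
  | bounce {v p : V} : Reach G C x v true → v ∈ C → G.Edge p v → Reach G C x p false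

/-- A collider opened by a descendant in `C` is simulated by walking down to the first vertex of
`C`, bouncing there and climbing back. -/
theorem Reach.parent {x v d p : V} (h : Reach G C x v true) (hd : d ∈ C)
    (ha : G.IsAncestor v d) (hp : G.Edge p v) : Reach G C x p false := by
  induction ha using Relation.ReflTransGen.head_induction_on generalizing p with
  | refl => exact h.bounce hd hp
  | @head v v' e _ ih =>
    by_cases hv : v ∈ C
    · exact h.bounce hv hp
    · exact (ih (h.down hv e) e).up hv hp

theorem Reach.of_isOpenWalk {x y : V} {w : List V} (hx : x ∉ C) (h : G.IsOpenWalk C x y w) :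
    ∃ d, Reach G C x y d := by
  have key : ∀ (l : List V) (u v : V), (u :: v :: l).IsChain G.Adjacent →
      (∀ a m b, [a, m, b] <:+: u :: v :: l → G.OpenTriple C a m b) →
      (G.Edge u v → Reach G C x v true) → (G.Edge v u → Reach G C x v false) →
      ∀ y, (u :: v :: l).getLast? = some y → ∃ d, Reach G C x y d := by
    intro l
    induction l with
    | nil =>
      intro u v hc _ h₁ h₂ y hy
      simp at hy
      subst hy
      rcases (List.isChain_cons_cons.1 hc).1 with h | h
      exacts [⟨_, h₁ h⟩, ⟨_, h₂ h⟩]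
    | cons w l ih =>
      intro u v hc ht h₁ h₂ y hy
      simp only [List.isChain_cons_cons] at hc
      have hT := ht u v w ⟨[], l, rfl⟩
      refine ih v w (List.isChain_cons_cons.2 hc.2)
        (fun a m b h => ht a m b (h.trans (List.suffix_cons _ _).isInfix)) ?_ ?_ y
        (by simpa using hy)
      · intro e
        have hv := hT.2 fun h => h.2.asymm e
        rcases hc.1 with h | h
        exacts [(h₁ h).down hv e, (h₂ h).down hv e]
      · intro e
        rcases hc.1 with h | h
        · obtain ⟨d, hd, ha⟩ := hT.1 h e
          exact (h₁ h).parent hd ha e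
        · exact (h₂ h).up (hT.2 fun h' => h'.1.asymm h) e
  obtain ⟨h₁, h₂, h₃, h₄⟩ := h
  match w with
  | [] => simp at h₂
  | [z] =>
    simp at h₂ h₃
    exact ⟨false, h₃ ▸ h₂ ▸ .start⟩
  | z :: v :: l =>
    simp at h₂
    subst h₂
    exact key l z v h₁ h₄ (fun e => Reach.start.down hx e) (fun e => Reach.start.up hx e) y h₃

/-- The walk is recorded backwards, from `v` to `x`, so that each step of `Reach` prepends a vertex.
-/
theorem Reach.exists_isOpenWalk {x v : V} {d : Bool} (h : Reach G C x v d) :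
    ∃ l, G.IsOpenWalk C v x (v :: l) ∧
      (d = true → ∃ u l', l = u :: l' ∧ G.Edge u v) ∧
      (d = false → ∀ u l', l = u :: l' → G.Edge v u) := by
  have ext : ∀ {v c : V} {l : List V}, G.IsOpenWalk C v x (v :: l) → G.Adjacent c v →
      (∀ u l', l = u :: l' → G.OpenTriple C c v u) → G.IsOpenWalk C c x (c :: v :: l) := by
    rintro v c l ⟨h₁, h₂, h₃, h₄⟩ hc ht
    refine ⟨List.isChain_cons_cons.2 ⟨hc, h₁⟩, rfl, by simpa using h₃, fun a m b h => ?_⟩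
    rcases List.infix_cons_iff.1 h with h | h
    · match l with
      | [] => simp at h
      | e :: l =>
        simp at h
        obtain ⟨rfl, rfl, rfl⟩ := h
        exact ht _ _ rfl
    · exact h₄ _ _ _ h
  induction h with
  | start =>
    refine ⟨[], ⟨by simp, rfl, rfl, fun a m b h => ?_⟩, by simp, by simp⟩
    simpa using h.length_le
  | @down v c d _ hv e ih =>
    obtain ⟨l, h₁, -, -⟩ := ih
    refine ⟨v :: l, ext h₁ (Or.inr e) fun u l' _ => ⟨fun h => (h.asymm e).elim, fun _ => hv⟩,
      fun _ => ⟨v, l, rfl, e⟩, by simp⟩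
  | @up v p _ hv e ih =>
    obtain ⟨l, h₁, -, h₃⟩ := ih
    refine ⟨v :: l, ext h₁ (Or.inl e) fun u l' hl => ⟨fun _ h => (h.asymm (h₃ rfl u l' hl)).elim,
      fun _ => hv⟩, by simp, ?_⟩
    rintro _ u l' hl
    obtain ⟨rfl, rfl⟩ := List.cons.inj hl
    exact e
  | @bounce v p _ hv e ih =>
    obtain ⟨l, h₁, h₂, -⟩ := ih
    obtain ⟨u, l', rfl, e'⟩ := h₂ rfl
    refine ⟨v :: u :: l', ext h₁ (Or.inl e) fun u l' hl => ?_, by simp, ?_⟩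
    · obtain ⟨rfl, rfl⟩ := List.cons.inj hl
      exact ⟨fun _ _ => ⟨v, hv, .refl⟩, fun h => (h ⟨e, e'⟩).elim⟩
    · rintro _ u l' hl
      obtain ⟨rfl, rfl⟩ := List.cons.inj hl
      exact e

theorem exists_active_iff_reach {x y : V} (hx : x ∉ C) (hy : y ∉ C) :
    (∃ p, G.IsPath x y p ∧ G.IsActive C x y p) ↔ ∃ d, Reach G C x y d := by
  constructor
  · rintro ⟨p, ⟨h₁, h₂, h₃, h₄⟩, -, -, h₅, h₆⟩
    refine Reach.of_isOpenWalk hx ⟨h₂, h₃, h₄, fun a v b h => ⟨fun e₁ e₂ => ?_, fun hn => ?_⟩⟩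
    · exact h₆ v ⟨a, b, h, e₁, e₂⟩
    · refine h₅ v ⟨⟨a, b, h⟩, ?_⟩
      rintro ⟨a', b', h', e₁, e₂⟩
      obtain ⟨rfl, rfl⟩ := triple_unique h₁ h h'
      exact hn ⟨e₁, e₂⟩
  · rintro ⟨d, h⟩
    obtain ⟨l, hl, -, -⟩ := h.exists_isOpenWalk
    obtain ⟨p, hp, h₁, h₂, h₃, h₄⟩ := hl.reverse.exists_nodup
    refine ⟨p, ⟨hp, h₁, h₂, h₃⟩, hx, hy, ?_, ?_⟩
    · rintro v ⟨⟨a, b, h⟩, hn⟩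
      exact (h₄ a v b h).2 fun e => hn ⟨a, b, h, e⟩
    · rintro v ⟨a, b, h, e₁, e₂⟩
      exact (h₄ a v b h).1 e₁ e₂

end DAG

/-! ### Markov equivalence determines skeleton and v-structures -/

namespace DAG

variable {G H K : DAG V} {C : Set V}

/-- `a → v ← b` is a v-structure of `G`. -/
def VStructure (G : DAG V) (a v b : V) : Prop :=
  G.Edge a v ∧ G.Edge b v ∧ a ≠ b ∧ ¬ G.Adjacent a b

theorem VStructure.symm {a v b : V} (h : G.VStructure a v b) : G.VStructure b v a :=
  ⟨h.2.1, h.1, h.2.2.1.symm, fun h' => h.2.2.2 h'.symm⟩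

/-- The same skeleton and the same v-structures. -/
def SamePattern (G H : DAG V) : Prop :=
  (∀ a b, G.Adjacent a b ↔ H.Adjacent a b) ∧
    ∀ a v b, G.VStructure a v b ↔ H.VStructure a v b

theorem SamePattern.symm (h : G.SamePattern H) : H.SamePattern G :=
  ⟨fun a b => (h.1 a b).symm, fun a v b => (h.2 a v b).symm⟩

theorem SamePattern.trans (h : G.SamePattern H) (h' : H.SamePattern K) : G.SamePattern K :=
  ⟨fun a b => (h.1 a b).trans (h'.1 a b), fun a v b => (h.2 a v b).trans (h'.2 a v b)⟩

theorem ext_edge (h : ∀ a b, G.Edge a b ↔ H.Edge a b) : G = H := by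
  obtain ⟨⟨A⟩, hA⟩ := G
  obtain ⟨⟨B⟩, hB⟩ := H
  obtain rfl : A = B := by
    ext a b
    exact h a b
  rfl

/-- A path that starts with a parent of `x` is blocked there. A path leaving `x` by an outgoing edge
is not directed, so it meets a collider below `x`; a descendant of that collider among the parents
of `x` would close a cycle. -/
theorem dSep_parents {x y : V} (hn : ¬ G.Adjacent x y) (ha : ¬ G.IsAncestor x y) :
    G.DSep {x} {y} {p | G.Edge p x} := by
  rintro _ rfl _ rfl p ⟨h₁, h₂, h₃, h₄⟩ ⟨-, -, h₅, h₆⟩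
  rename_i x y
  match p with
  | [] => simp at h₃
  | [z] =>
    simp at h₃ h₄
    exact ha (h₄ ▸ h₃ ▸ .refl)
  | z :: q :: l =>
    simp at h₃
    subst h₃
    rcases (List.isChain_cons_cons.1 h₂).1 with e | e
    · rcases transGen_or_exists_collider h₂ e h₄ with h | ⟨a, v, b, i₁, i₂, i₃, i₄⟩
      · exact ha h.to_reflTransGen
      · obtain ⟨d, hd, hv⟩ := h₆ v ⟨a, b, i₁, i₂, i₃⟩
        exact G.acyclic z (.tail' (i₄.trans hv) hd)
    · match l with
      | [] =>
        simp at h₄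
        exact hn (Or.inr (h₄ ▸ e))
      | r :: l =>
        by_cases hq : G.IsCollider (z :: q :: r :: l) q
        · obtain ⟨a, b, i₁, i₂, -⟩ := hq
          obtain ⟨rfl, -⟩ := triple_unique h₁ i₁ ⟨[], l, rfl⟩
          exact i₂.asymm e
        · exact h₅ q ⟨⟨z, r, [], l, rfl⟩, hq⟩ e

theorem MarkovEquiv.dSep_iff (h : G.MarkovEquiv H) {x y : V} (hxy : x ≠ y) (hx : x ∉ C)
    (hy : y ∉ C) : G.DSep {x} {y} C ↔ H.DSep {x} {y} C := by
  have := Set.ext_iff.1 h ({x}, {y}, C)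
  simpa [dsepRelations, hxy, hx, hy] using this

theorem MarkovEquiv.refl (G : DAG V) : G.MarkovEquiv G := Eq.refl _

theorem MarkovEquiv.symm (h : G.MarkovEquiv H) : H.MarkovEquiv G := Eq.symm h

theorem MarkovEquiv.trans (h : G.MarkovEquiv H) (h' : H.MarkovEquiv K) : G.MarkovEquiv K :=
  Eq.trans h h'

theorem isAncestor_antisymm {x y : V} (h : G.IsAncestor x y) (h' : G.IsAncestor y x) :
    x = y := by
  rcases Relation.reflTransGen_iff_eq_or_transGen.1 h with h | h
  · exact h.symm
  · exact (G.acyclic x (h.trans_left h')).elim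

theorem MarkovEquiv.adjacent (h : G.MarkovEquiv H) {x y : V} (hG : G.Adjacent x y) :
    H.Adjacent x y := by
  by_contra hH
  have hne : x ≠ y := by
    rintro rfl
    rcases hG with e | e <;> exact e.ne rfl
  wlog ha : ¬ H.IsAncestor x y generalizing x y
  · exact this hG.symm (fun h => hH h.symm) hne.symm
      fun h' => hne (isAncestor_antisymm (not_not.1 ha) h')
  have hx : x ∉ {p | H.Edge p x} := fun e => Edge.ne e rfl
  have hy : y ∉ {p | H.Edge p x} := fun e => hH (Or.inr e)
  refine (h.dSep_iff hne hx hy).2 (dSep_parents hH ha) x rfl y rfl [x, y]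
    ⟨by simpa using hne, by simpa using hG, rfl, rfl⟩ ⟨hx, hy, ?_, ?_⟩
  · rintro v ⟨⟨a, b, i⟩, -⟩
    simpa using i.length_le
  · rintro v ⟨a, b, i, -⟩
    simpa using i.length_le

/-- The parents of `a` in `H` separate `a` from `b` and omit `v`; were `v` a non-collider in `G`,
the path `a, v, b` would be active there. -/
theorem MarkovEquiv.vStructure (h : G.MarkovEquiv H) {a v b : V} (hH : H.VStructure a v b) :
    G.VStructure a v b := by
  by_contra hG
  wlog ha : ¬ H.IsAncestor a b generalizing a b
  · exact this hH.symm (fun h => hG h.symm)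
      fun h' => hH.2.2.1 (isAncestor_antisymm (not_not.1 ha) h')
  obtain ⟨e₁, e₂, hne, hn⟩ := hH
  have hnG : ¬ G.Adjacent a b := fun h' => hn (h.adjacent h')
  have hx : a ∉ {p | H.Edge p a} := fun e => Edge.ne e rfl
  have hy : b ∉ {p | H.Edge p a} := fun e => hn (Or.inr e)
  have h₁ := h.symm.adjacent (Or.inl e₁)
  have h₂ := h.symm.adjacent (Or.inr e₂)
  have hnd : [a, v, b].Nodup := by simp [e₁.ne, hne, e₂.ne.symm]
  refine (h.dSep_iff hne hx hy).2 (dSep_parents hn ha) a rfl b rfl [a, v, b]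
    ⟨hnd, by simp [h₁, h₂], rfl, rfl⟩ ⟨hx, hy, ?_, ?_⟩
  · rintro w ⟨⟨c, d, i⟩, -⟩
    have := i.eq_of_length rfl
    simp at this
    obtain ⟨-, rfl, -⟩ := this
    exact fun e => e₁.asymm e
  · rintro w ⟨c, d, i, i₁, i₂⟩
    have := i.eq_of_length rfl
    simp at this
    obtain ⟨rfl, rfl, rfl⟩ := this
    exact (hG ⟨i₁, i₂, hne, hnG⟩).elim

theorem MarkovEquiv.samePattern (h : G.MarkovEquiv H) : G.SamePattern H :=
  ⟨fun _ _ => ⟨h.adjacent, h.symm.adjacent⟩, fun _ _ _ => ⟨h.symm.vStructure, h.vStructure⟩⟩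

/-! ### Reversing covered edges -/

/-- The edge `a → b` is covered: the parents of `b` are `a` and the parents of `a`. -/
def Covered (G : DAG V) (a b : V) : Prop := ∀ p, G.Edge p b ↔ p = a ∨ G.Edge p a

/-- The DAG obtained by reversing a covered edge. -/
def reverseEdge (G : DAG V) (a b : V) (h : G.Covered a b) : DAG V where
  Adj u v := (G.Edge u v ∧ ¬ (u = a ∧ v = b)) ∨ (u = b ∧ v = a)
  acyclic := by
    have hab : G.Edge a b := (h a).2 (Or.inl rfl)
    -- A path into `b` continued by `b → a` is replaced by a `G`-path into `a`, since every other
    -- parent of `b` is a parent of `a`.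
    have key : ∀ {u v : V}, Relation.TransGen
        (fun u v => (G.Edge u v ∧ ¬ (u = a ∧ v = b)) ∨ (u = b ∧ v = a)) u v →
        (Relation.TransGen G.Edge u v ∧ ¬ (u = a ∧ v = b)) ∨ (u = b ∧ v = a) ∨
          (u = b ∧ Relation.TransGen G.Edge a v ∧ v ≠ b) := by
      intro u v huv
      induction huv with
      | single e =>
        rcases e with ⟨e, e'⟩ | e
        exacts [Or.inl ⟨.single e, e'⟩, Or.inr (Or.inl e)]
      | @tail v w _ e ih =>
        rcases e with ⟨e, e'⟩ | ⟨rfl, rfl⟩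
        · rcases ih with ⟨i, i'⟩ | ⟨rfl, rfl⟩ | ⟨rfl, i, i'⟩
          · refine Or.inl ⟨i.tail e, ?_⟩
            rintro ⟨rfl, rfl⟩
            rcases (h v).1 e with rfl | e
            exacts [G.acyclic _ i, G.acyclic _ (i.tail e)]
          · exact Or.inr (Or.inr ⟨rfl, .single e, fun hw => e' ⟨rfl, hw⟩⟩)
          · refine Or.inr (Or.inr ⟨rfl, i.tail e, ?_⟩)
            rintro rfl
            rcases (h v).1 e with rfl | e
            exacts [G.acyclic _ i, G.acyclic _ (i.tail e)]
        · rcases ih with ⟨i, i'⟩ | ⟨rfl, rfl⟩ | ⟨rfl, i, i'⟩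
          · refine Or.inl ⟨?_, fun hh => hab.ne hh.2⟩
            obtain ⟨p, hp, e⟩ := Relation.TransGen.tail'_iff.1 i
            rcases (h p).1 e with rfl | e
            · rcases Relation.reflTransGen_iff_eq_or_transGen.1 hp with rfl | hp
              exacts [(i' ⟨rfl, rfl⟩).elim, hp]
            · exact .tail' hp e
          · exact (hab.ne rfl).elim
          · exact (i' rfl).elim
    intro v hv
    rcases key hv with ⟨i, -⟩ | ⟨rfl, rfl⟩ | ⟨rfl, -, i⟩
    exacts [G.acyclic v i, hab.ne rfl, i rfl]

theorem reverseEdge_edge {a b u v : V} (h : G.Covered a b) :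
    (G.reverseEdge a b h).Edge u v ↔ (G.Edge u v ∧ ¬ (u = a ∧ v = b)) ∨ (u = b ∧ v = a) :=
  Iff.rfl

theorem Covered.reverse {a b : V} (h : G.Covered a b) : (G.reverseEdge a b h).Covered b a := by
  intro p
  have hab : G.Edge a b := (h a).2 (Or.inl rfl)
  have := h p
  have h₁ : ¬ G.Edge a a := G.acyclic a ∘ .single
  have h₂ : ¬ G.Edge b b := G.acyclic b ∘ .single
  have := hab.ne
  simp only [reverseEdge_edge]
  grind

theorem Covered.reverse_reverse {a b : V} (h : G.Covered a b) :
    (G.reverseEdge a b h).reverseEdge b a h.reverse = G := by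
  have hab : G.Edge a b := (h a).2 (Or.inl rfl)
  refine ext_edge fun u v => ?_
  have := hab.asymm
  have := hab.ne
  simp only [reverseEdge_edge]
  grind

theorem Covered.samePattern {a b : V} (h : G.Covered a b) :
    G.SamePattern (G.reverseEdge a b h) := by
  have hab : G.Edge a b := (h a).2 (Or.inl rfl)
  have hba := hab.asymm
  have adj : ∀ u v, G.Adjacent u v ↔ (G.reverseEdge a b h).Adjacent u v := by
    intro u v
    simp only [Adjacent, reverseEdge_edge]
    grind
  refine ⟨adj, fun u v w => ?_⟩
  have h₁ := h u
  have h₂ := h w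
  have hne := hab.ne
  simp only [VStructure, ← adj]
  simp only [Adjacent, reverseEdge_edge]
  grind

theorem Reach.reverseEdge {a b x y : V} {d : Bool} (h : G.Covered a b) (hr : Reach G C x y d) :
    ∃ d, Reach (G.reverseEdge a b h) C x y d := by
  have hab : G.Edge a b := (h a).2 (Or.inl rfl)
  have hba := hab.asymm
  have hne := hab.ne
  have haa : ¬ G.Edge a a := G.acyclic a ∘ .single
  have hbb : ¬ G.Edge b b := G.acyclic b ∘ .single
  have hE : ∀ u v, (G.reverseEdge a b h).Edge u v ↔
      (G.Edge u v ∧ ¬ (u = a ∧ v = b)) ∨ (u = b ∧ v = a) := fun _ _ => Iff.rfl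
  generalize G.reverseEdge a b h = H at hE
  have U : ∀ u, Reach H C x u false → u ∉ C → ∀ p, H.Edge p u → Reach H C x p false :=
    fun _ h₁ h₂ _ => h₁.up h₂
  have D : ∀ u d, Reach H C x u d → u ∉ C → ∀ c, H.Edge u c → Reach H C x c true :=
    fun _ _ h₁ h₂ _ => h₁.down h₂
  have B : ∀ u, Reach H C x u true → u ∈ C → ∀ p, H.Edge p u → Reach H C x p false :=
    fun _ h₁ h₂ _ => h₁.bounce h₂
  -- As `a` and `b` share their other parents, an arrow from such a parent into one can be
  -- redirected into the other. The last two clauses cover arrivals that may have used the reversed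
  -- edge.
  have key : ∀ y d, Reach G C x y d →
      (y ≠ a → y ≠ b → Reach H C x y d) ∧
      (y = a → d = true → Reach H C x a true ∧ Reach H C x b true) ∧
      (y = b → d = false → Reach H C x b false) ∧
      (y = a → d = false → Reach H C x a false ∨
        (Reach H C x a true ∧ Reach H C x b true ∧ b ∈ C) ∨
        (Reach H C x a true ∧ Reach H C x b false ∧ b ∉ C)) ∧
      (y = b → d = true → (Reach H C x a true ∧ Reach H C x b true) ∨
        (Reach H C x a false ∧ Reach H C x b false ∧ a ∉ C) ∨
        (Reach H C x b false ∧ b ∉ C)) := by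
    intro y d hr
    induction hr with
    | start =>
      have := Reach.start (G := H) (C := C) (x := x)
      grind
    | @down v c d hr hv e ih =>
      have hc := h v
      by_cases h₁ : v = a <;> by_cases h₂ : v = b <;> by_cases h₃ : c = a <;>
        by_cases h₄ : c = b <;> cases d <;> grind
    | @up v p hr hv e ih =>
      have hc := h p
      by_cases h₁ : v = a <;> by_cases h₂ : v = b <;> by_cases h₃ : p = a <;>
        by_cases h₄ : p = b <;> grind
    | @bounce v p hr hv e ih =>
      have hc := h p
      by_cases h₁ : v = a <;> by_cases h₂ : v = b <;> by_cases h₃ : p = a <;>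
        by_cases h₄ : p = b <;> grind
  have := key y d hr
  by_cases hya : y = a <;> by_cases hyb : y = b <;> cases d <;> grind

theorem Covered.markovEquiv {a b : V} (h : G.Covered a b) :
    G.MarkovEquiv (G.reverseEdge a b h) := by
  have key : ∀ C x y, (∃ d, Reach G C x y d) ↔ ∃ d, Reach (G.reverseEdge a b h) C x y d := by
    refine fun C x y => ⟨fun ⟨d, hd⟩ => hd.reverseEdge h, fun ⟨d, hd⟩ => ?_⟩
    have := hd.reverseEdge h.reverse
    rwa [h.reverse_reverse] at this
  have dsep : ∀ {K : DAG V} {A B C : Set V}, Disjoint A C → Disjoint B C →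
      (K.DSep A B C ↔ ∀ x ∈ A, ∀ y ∈ B, ¬ ∃ d, Reach K C x y d) := by
    refine fun hA hB => forall₄_congr fun x hx y hy => ?_
    rw [← exists_active_iff_reach (hA.notMem_of_mem_left hx) (hB.notMem_of_mem_left hy)]
    simp
  ext ⟨A, B, C⟩
  refine and_congr_right fun _ => and_congr_right fun hA => and_congr_right fun hB => ?_
  rw [dsep hA hB, dsep hA hB]
  simp only [key]

/-- Distinct DAGs with the same pattern differ in an edge that is covered in the first one. -/
theorem SamePattern.exists_covered [Finite V] (h : G.SamePattern H) (hne : G ≠ H) :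
    ∃ a b, G.Covered a b ∧ H.Edge b a := by
  have adjH : ∀ {u v}, G.Edge u v → ¬ H.Edge v u → H.Edge u v := fun e e' =>
    ((h.1 _ _).1 (Or.inl e)).resolve_right e'
  have : Std.Irrefl (Relation.TransGen G.Edge) := ⟨G.acyclic⟩
  have : IsStrictOrder V (Relation.TransGen G.Edge) := {}
  have : Std.Irrefl (Function.swap (Relation.TransGen G.Edge)) := ⟨G.acyclic⟩
  have : IsStrictOrder V (Function.swap (Relation.TransGen G.Edge)) := {}
  have hw := Finite.wellFounded_of_trans_of_irrefl (Relation.TransGen G.Edge)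
  have hw' := Finite.wellFounded_of_trans_of_irrefl (Function.swap (Relation.TransGen G.Edge))
  have h₀ : {b | ∃ a, G.Edge a b ∧ H.Edge b a}.Nonempty := by
    by_contra hemp
    rw [Set.not_nonempty_iff_eq_empty, Set.eq_empty_iff_forall_notMem] at hemp
    refine hne (ext_edge fun u v => ⟨fun e => adjH e fun e' => hemp v ⟨u, e, e'⟩, fun e => ?_⟩)
    exact ((h.1 _ _).2 (Or.inl e)).resolve_right fun e' => hemp u ⟨v, e', e⟩
  -- Take `b` earliest in `G` among the heads of edges on which the DAGs disagree, then `a` latest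
  -- among the tails of such edges into `b`.
  obtain ⟨b, hb, hbmin⟩ := hw.has_min _ h₀
  obtain ⟨a, ⟨hab, hba⟩, hamax⟩ := hw'.has_min {a | G.Edge a b ∧ H.Edge b a} hb
  refine ⟨a, b, fun p => ⟨fun hp => ?_, ?_⟩, hba⟩
  · by_cases hpa : p = a
    · exact Or.inl hpa
    right
    have hadj : G.Adjacent p a := by
      by_contra hn
      exact hba.asymm (((h.2 p b a).1 ⟨hp, hab, hpa, hn⟩).2.1)
    refine hadj.resolve_right fun hap => ?_
    by_cases hbp : H.Edge b p
    · exact hamax p ⟨hp, hbp⟩ (.single hap)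
    · exact hbmin p ⟨a, hap, edge_of_trans (adjH hp hbp) hba ((h.1 _ _).1 hadj)⟩ (.single hp)
  · rintro (rfl | hpa)
    · exact hab
    have hpb : p ≠ b := by
      rintro rfl
      exact hab.asymm hpa
    have hpa' : H.Edge p a := adjH hpa fun e => hbmin a ⟨p, hpa, e⟩ (.single hab)
    have hadj : G.Adjacent p b := by
      by_contra hn
      exact hab.asymm ((h.2 p a b).2 ⟨hpa', hba, hpb, fun h' => hn ((h.1 _ _).2 h')⟩).2.1
    exact edge_of_trans hpa hab hadj

/-- DAGs with the same skeleton and v-structures are Markov equivalent. -/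
theorem SamePattern.markovEquiv [Finite V] (h : G.SamePattern H) : G.MarkovEquiv H := by
  induction hn : {e : V × V | G.Edge e.1 e.2 ∧ H.Edge e.2 e.1}.ncard using
    Nat.strong_induction_on generalizing G with
  | _ n ih =>
    by_cases hne : G = H
    · exact hne ▸ .refl G
    obtain ⟨a, b, hc, hba⟩ := h.exists_covered hne
    have hab : G.Edge a b := (hc a).2 (Or.inl rfl)
    refine hc.markovEquiv.trans (ih _ ?_ (hc.samePattern.symm.trans h) rfl)
    rw [← hn]
    refine Set.ncard_lt_ncard ⟨?_, fun hs => ?_⟩ (Set.toFinite _)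
    · rintro ⟨u, v⟩ ⟨e | ⟨rfl, rfl⟩, e'⟩
      exacts [⟨e.1, e'⟩, (hba.asymm e').elim]
    · rcases (hs (show (a, b) ∈ _ from ⟨hab, hba⟩)).1 with e | e
      exacts [e.2 ⟨rfl, rfl⟩, hab.ne e.1]

end DAG

/-! ### Perfect elimination orderings -/

/-- In the list, the `U`-neighbours of a vertex that come after it form a clique. -/
def IsPerfectElimination (U : V → V → Prop) : List V → Prop
  | [] => True
  | v :: l => (∀ a ∈ l, ∀ b ∈ l, U v a → U v b → a ≠ b → U a b) ∧ IsPerfectElimination U l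

theorem IsPerfectElimination.insert {U : V → V → Prop} (hs : ∀ a b, U a b → U b a) {v : V}
    {A B : List V} (h : IsPerfectElimination U (A ++ B))
    (hp : (A ++ B).Pairwise fun a c => U v a → U a c → U v c)
    (hc : ∀ a ∈ B, ∀ b ∈ B, U v a → U v b → a ≠ b → U a b) :
    IsPerfectElimination U (A ++ v :: B) := by
  induction A with
  | nil => exact ⟨hc, h⟩
  | cons a A ih =>
    obtain ⟨h₁, h₂⟩ := h
    rw [List.cons_append, List.pairwise_cons] at hp
    refine ⟨?_, ih h₂ hp.2⟩
    have hm : ∀ b, b ∈ A ++ v :: B → b ≠ v → b ∈ A ++ B := by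
      intro b hb hne
      simp only [List.mem_append, List.mem_cons] at hb ⊢
      tauto
    intro b hb c hc hab hac hbc
    by_cases hbv : b = v
    · subst hbv
      exact hp.1 c (hm c hc hbc.symm) (hs _ _ hab) hac
    · by_cases hcv : c = v
      · subst hcv
        exact hs _ _ (hp.1 b (hm b hb hbv) (hs _ _ hac) hab)
      · exact h₁ b (hm b hb hbv) c (hm c hc hcv) hab hac hbc

open Classical in
theorem IsPerfectElimination.adj {U : V → V → Prop} {L : List V} (h : IsPerfectElimination U L)
    {a b c : V} (ha : a ∈ L) (hb : b ∈ L) (hac : U c a) (hbc : U c b) (hab : a ≠ b)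
    (h₁ : L.idxOf c < L.idxOf a) (h₂ : L.idxOf c < L.idxOf b) : U a b := by
  induction L with
  | nil => simp at ha
  | cons v l ih =>
    have hav : v ≠ a := by
      rintro rfl
      simp at h₁
    have hbv : v ≠ b := by
      rintro rfl
      simp at h₂
    have ha' := (List.mem_cons.1 ha).resolve_left hav.symm
    have hb' := (List.mem_cons.1 hb).resolve_left hbv.symm
    by_cases hcv : v = c
    · subst hcv
      exact h.1 a ha' b hb' hac hbc hab
    · rw [List.idxOf_cons_ne _ hcv, List.idxOf_cons_ne _ hav] at h₁
      rw [List.idxOf_cons_ne _ hcv, List.idxOf_cons_ne _ hbv] at h₂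
      exact ih h.2 ha' hb' (by omega) (by omega)

namespace DAG

variable {G H : DAG V}

theorem exists_sink (G : DAG V) {s : Finset V} (hs : s.Nonempty) :
    ∃ v ∈ s, ∀ w ∈ s, ¬ G.Edge v w := by
  by_contra! h
  have hs' : Finite s := inferInstance
  let r : s → s → Prop := fun a b => Relation.TransGen G.Edge b.1 a.1
  have : Std.Irrefl r := ⟨fun a => G.acyclic a⟩
  have : IsTrans s r := ⟨fun a b c h₁ h₂ => h₂.trans h₁⟩
  have hw := Finite.wellFounded_of_trans_of_irrefl r
  obtain ⟨v, hv⟩ := hs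
  obtain ⟨m, -, hm⟩ := hw.has_min Set.univ ⟨⟨v, hv⟩, trivial⟩
  obtain ⟨w, hw, e⟩ := h m m.2
  exact hm ⟨w, hw⟩ trivial (.single e)

/-- If `U` is a set of edges of a DAG without unshielded colliders, then every `U`-clique is an
initial piece of a perfect elimination ordering (in reverse) of `U`. -/
theorem exists_isPerfectElimination (G : DAG V) {U : V → V → Prop} (hs : ∀ a b, U a b → U b a)
    (hU : ∀ a b, U a b → G.Adjacent a b)
    (hp : ∀ a b c, U c a → U c b → G.Edge a c → G.Edge b c → a ≠ b → U a b) (s : Finset V) :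
    ∀ K : List V, K.Nodup → (∀ v ∈ K, v ∈ s) → K.Pairwise U →
      ∃ L : List V, L.Nodup ∧ (∀ v, v ∈ L ↔ v ∈ s) ∧ IsPerfectElimination U L ∧ K <:+ L := by
  classical
  induction s using Finset.strongInduction with
  | H s ih =>
    intro K hK hKs hKU
    rcases s.eq_empty_or_nonempty with rfl | hne
    · obtain rfl : K = [] := List.eq_nil_iff_forall_not_mem.2 fun v hv => by simpa using hKs v hv
      exact ⟨[], by simp, by simp, trivial, List.suffix_refl _⟩
    obtain ⟨v, hv, hsink⟩ := G.exists_sink hne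
    have clique : ∀ a ∈ s, ∀ b ∈ s, U v a → U v b → a ≠ b → U a b := fun a ha b hb h₁ h₂ =>
      hp a b v h₁ h₂ ((hU _ _ h₁).resolve_left (hsink a ha))
        ((hU _ _ h₂).resolve_left (hsink b hb))
    by_cases hvK : v ∈ K
    · obtain ⟨A, B, rfl⟩ := List.append_of_mem hvK
      have hAB : ∀ a ∈ A ++ B, a ∈ s ∧ a ≠ v ∧ U v a := by
        intro a ha
        rw [List.pairwise_append, List.pairwise_cons] at hKU
        rw [List.nodup_append, List.nodup_cons] at hK
        refine ⟨hKs a (by simp at ha ⊢; tauto), ?_, ?_⟩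
        · rintro rfl
          rcases List.mem_append.1 ha with h | h
          exacts [hK.2.2 _ h _ (by simp) rfl, hK.2.1.1 h]
        · rcases List.mem_append.1 ha with h | h
          exacts [hs _ _ (hKU.2.2 _ h _ (by simp)), hKU.2.1.1 _ h]
      -- The sink `v` lies in the prescribed clique. Its neighbours form a clique, so all of them
      -- can be put at the end of the ordering of the rest, and `v` is then inserted at its place
      -- among them; the remaining part `T` has no neighbour of `v`.
      let N := ((s.erase v).filter fun a => U v a ∧ a ∉ A ++ B).toList
      have hN : ∀ a, a ∈ N ↔ a ≠ v ∧ a ∈ s ∧ U v a ∧ a ∉ A ++ B := by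
        intro a
        simp [N, and_assoc]
      have hM : ∀ a ∈ N ++ (A ++ B), a ∈ s ∧ a ≠ v ∧ U v a := by
        intro a ha
        rcases List.mem_append.1 ha with h | h
        · have := (hN a).1 h
          tauto
        · exact hAB a h
      have hnd : (A ++ B).Nodup :=
        hK.sublist ((List.sublist_cons_self v B).append_left A)
      have hMnd : (N ++ (A ++ B)).Nodup :=
        List.nodup_append.2 ⟨Finset.nodup_toList _, hnd, fun a ha b hb hab =>
          ((hN a).1 ha).2.2.2 (hab ▸ hb)⟩
      obtain ⟨L, hL, hLs, hLp, T, rfl⟩ := ih (s.erase v) (Finset.erase_ssubset hv)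
        (N ++ (A ++ B)) hMnd (fun a ha => by have := hM a ha; simp; tauto)
        (hMnd.pairwise_of_forall_ne fun a ha b hb hab =>
          clique a (hM a ha).1 b (hM b hb).1 (hM a ha).2.2 (hM b hb).2.2 hab)
      have hT : ∀ a ∈ T, ¬ U v a := by
        intro a ha hva
        have h₁ := (hLs a).1 (List.mem_append_left _ ha)
        have h₂ : a ∉ N ++ (A ++ B) := fun h => (List.nodup_append.1 hL).2.2 a ha a h rfl
        rw [List.mem_append, hN] at h₂
        rw [Finset.mem_erase] at h₁
        tauto
      have hvL : v ∉ T ++ (N ++ (A ++ B)) := fun h => by simpa using (hLs v).1 h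
      have perm : (T ++ (N ++ (A ++ v :: B))).Perm (v :: (T ++ (N ++ (A ++ B)))) := by
        simpa using List.perm_middle (l₁ := T ++ (N ++ A)) (l₂ := B) (a := v)
      refine ⟨T ++ (N ++ (A ++ v :: B)), perm.nodup_iff.2 (List.nodup_cons.2 ⟨hvL, hL⟩), ?_, ?_,
        ⟨T ++ N, by simp⟩⟩
      · intro a
        rw [perm.mem_iff, List.mem_cons, hLs, Finset.mem_erase]
        by_cases hav : a = v
        · simp [hav, hv]
        · simp [hav]
      · have : T ++ (N ++ (A ++ v :: B)) = (T ++ (N ++ A)) ++ v :: B := by simp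
        rw [this]
        have e : T ++ (N ++ A) ++ B = T ++ (N ++ (A ++ B)) := by simp
        refine IsPerfectElimination.insert hs (e ▸ hLp) ?_ ?_
        · rw [e, List.pairwise_append]
          refine ⟨List.pairwise_of_forall_mem_list fun a ha b _ h => (hT a ha h).elim,
            List.pairwise_of_forall_mem_list fun a _ b hb _ _ => (hM b hb).2.2,
            fun a ha b _ h => (hT a ha h).elim⟩
        · have hB : ∀ a ∈ B, a ∈ s := fun a ha => (hAB a (List.mem_append_right _ ha)).1
          exact fun a ha b hb => clique a (hB a ha) b (hB b hb)
    · obtain ⟨L, hL, hLs, hLp, hKL⟩ := ih (s.erase v) (Finset.erase_ssubset hv) K hK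
        (fun a ha => Finset.mem_erase.2 ⟨fun h => hvK (h ▸ ha), hKs a ha⟩) hKU
      have hmem : ∀ a ∈ L, a ∈ s := fun a ha => (Finset.mem_erase.1 ((hLs a).1 ha)).2
      refine ⟨v :: L, List.nodup_cons.2 ⟨fun h => by simpa using (hLs v).1 h, hL⟩, fun a => ?_,
        ⟨fun a ha b hb => clique a (hmem a ha) b (hmem b hb), hLp⟩,
        hKL.trans (List.suffix_cons _ _)⟩
      rw [List.mem_cons, hLs, Finset.mem_erase]
      by_cases hav : a = v
      · simp [hav, hv]
      · simp [hav]

theorem exists_perfect_ranking [Finite V] (G : DAG V) {U : V → V → Prop}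
    (hs : ∀ a b, U a b → U b a) (hU : ∀ a b, U a b → G.Adjacent a b)
    (hp : ∀ a b c, U c a → U c b → G.Edge a c → G.Edge b c → a ≠ b → U a b) (x : V) :
    ∃ f : V → ℕ, Function.Injective f ∧ (∀ c, c ≠ x → f c < f x) ∧
      ∀ a b c, U c a → U c b → f c < f a → f c < f b → a ≠ b → U a b := by
  classical
  have := Fintype.ofFinite V
  obtain ⟨L, hL, hLs, hLp, T, rfl⟩ :=
    G.exists_isPerfectElimination hs hU hp Finset.univ [x] (by simp) (by simp) (by simp)
  have hmem : ∀ v, v ∈ T ++ [x] := fun v => (hLs v).2 (Finset.mem_univ v)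
  refine ⟨fun v => (T ++ [x]).idxOf v, fun a b h => (List.idxOf_inj (hmem a)).1 h, fun c hc => ?_,
    fun a b c h₁ h₂ h₃ h₄ h₅ => hLp.adj (hmem a) (hmem b) h₁ h₂ h₅ h₃ h₄⟩
  have hcT : c ∈ T := by
    have := hmem c
    simp [hc] at this
    exact this
  have hxT : x ∉ T := fun h => (List.nodup_append.1 hL).2.2 x h x (by simp) rfl
  simp only [List.idxOf_append_of_mem hcT, List.idxOf_append_of_notMem hxT]
  exact Nat.lt_add_right _ (List.idxOf_lt_length_of_mem hcT)

/-! ### Meek's rules and rooted orientations -/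

/-- The edges obtained from the v-structures by closing under Meek's orientation rules. -/
inductive Compelled (G : DAG V) : V → V → Prop
  | vStructure {a v b : V} : G.VStructure a v b → Compelled G a v
  | unshielded {d a b : V} : Compelled G d a → G.Edge a b → ¬ G.Adjacent d b → Compelled G a b
  | trans {a d b : V} : Compelled G a d → Compelled G d b → G.Edge a b → Compelled G a b
  | kite {a b d e : V} : G.Edge a b → Compelled G d b → Compelled G e b → G.Adjacent d a →
      G.Adjacent e a → d ≠ e → ¬ G.Adjacent d e → ¬ G.VStructure d a e → Compelled G a b

theorem Compelled.edge {a b : V} (h : G.Compelled a b) : G.Edge a b := by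
  cases h with
  | vStructure h => exact h.1
  | unshielded _ e => exact e
  | trans _ _ e => exact e
  | kite e => exact e

theorem Compelled.edge_of_samePattern {a b : V} (h : G.Compelled a b) (hGH : G.SamePattern H) :
    H.Edge a b := by
  induction h with
  | vStructure h => exact ((hGH.2 _ _ _).1 h).1
  | @unshielded d a b h e hn ih =>
    by_contra hab
    have hba := ((hGH.1 _ _).1 (Or.inl e)).resolve_left hab
    have hne : d ≠ b := by
      rintro rfl
      exact h.edge.asymm e
    have := (hGH.2 d a b).2 ⟨ih, hba, hne, fun h => hn ((hGH.1 _ _).2 h)⟩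
    exact e.asymm this.2.1
  | trans _ _ e ih₁ ih₂ => exact edge_of_trans ih₁ ih₂ ((hGH.1 _ _).1 (Or.inl e))
  | @kite a b d e hab _ _ hd he hne hn hv ih₁ ih₂ =>
    refine ((hGH.1 _ _).1 (Or.inl hab)).resolve_right fun hba => hv ((hGH.2 _ _ _).2 ?_)
    exact ⟨edge_of_trans ih₁ hba ((hGH.1 _ _).1 hd), edge_of_trans ih₂ hba ((hGH.1 _ _).1 he), hne,
      fun h => hn ((hGH.1 _ _).2 h)⟩

/-- `a` and `b` are adjacent, and their edge is not compelled. -/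
def Free (G : DAG V) (a b : V) : Prop :=
  G.Adjacent a b ∧ ¬ G.Compelled a b ∧ ¬ G.Compelled b a

theorem Free.symm {a b : V} (h : G.Free a b) : G.Free b a := ⟨h.1.symm, h.2.2, h.2.1⟩

theorem Free.ne {a b : V} (h : G.Free a b) : a ≠ b := h.1.elim Edge.ne fun e => e.ne.symm

theorem Compelled.compelled_or_free {a b c : V} (h : G.Compelled a b) (hf : G.Free b c) :
    G.Compelled a c ∨ G.Free a c := by
  have hne : a ≠ c := by
    rintro rfl
    exact hf.2.2 h
  have hadj : G.Adjacent a c := by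
    by_contra hn
    rcases hf.1 with e | e
    · exact hf.2.1 (h.unshielded e hn)
    · exact hf.2.2 (.vStructure (VStructure.symm ⟨h.edge, e, hne, hn⟩))
  by_cases hac : G.Compelled a c
  · exact Or.inl hac
  · refine Or.inr ⟨hadj, hac, fun hca => hf.2.2 (hca.trans h ?_)⟩
    exact edge_of_trans hca.edge h.edge hf.1.symm

/-- By `compelled_or_free` it suffices to exclude that `a — c` is free, or to derive `a → c`
directly. Induction on the derivation does this: the rule that gave `a → b` can be replayed with `c`
for `b`, or a forbidden adjacency or a compelled edge assumed free appears. -/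
theorem Compelled.trans_free {a b c : V} (h : G.Compelled a b) (hf : G.Free b c) :
    G.Compelled a c := by
  induction h generalizing c with
  | @vStructure a b e h =>
    have ha := Compelled.vStructure h
    have he := Compelled.vStructure h.symm
    obtain ⟨h₁, h₂, hne, hn⟩ := h
    refine (ha.compelled_or_free hf).resolve_right fun hac => ?_
    rcases he.compelled_or_free hf with hec | hec
    · rcases hec.compelled_or_free hac.symm with h | h
      exacts [hn (Or.inr h.edge), hn h.1.symm]
    · by_cases hv : G.VStructure a c e
      · exact hac.2.1 (.vStructure hv)
      rcases hf.1 with e' | e'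
      · exact hv ⟨edge_of_trans h₁ e' hac.1, edge_of_trans h₂ e' hec.1, hne, hn⟩
      · exact hf.2.2 (.kite e' ha he hac.1 hec.1 hne hn hv)
  | @unshielded d a b h e hn ih =>
    refine ((h.unshielded e hn).compelled_or_free hf).resolve_right fun hac => ?_
    rcases (ih hac).compelled_or_free hf.symm with h | h
    exacts [hn (Or.inl h.edge), hn h.1]
  | @trans a d b h₁ h₂ e ih₁ ih₂ =>
    refine ((h₁.trans h₂ e).compelled_or_free hf).elim id fun hac => ?_
    exact h₁.trans (ih₂ hf) (edge_of_trans h₁.edge (ih₂ hf).edge hac.1)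
  | @kite a b d e hab h₁ h₂ hd he hne hn hv ih₁ ih₂ =>
    refine ((Compelled.kite hab h₁ h₂ hd he hne hn hv).compelled_or_free hf).elim id fun hac => ?_
    refine .kite (hac.1.resolve_right fun hca => hv ?_) (ih₁ hf) (ih₂ hf) hd he hne hn hv
    exact ⟨edge_of_trans (ih₁ hf).edge hca hd, edge_of_trans (ih₂ hf).edge hca he, hne, hn⟩

/-- The orientation of `G` that keeps the compelled edges and orients the others by decreasing
`f`. -/
def orient (G : DAG V) (f : V → ℕ) : DAG V where
  Adj a b := G.Compelled a b ∨ (G.Free a b ∧ f b < f a)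
  acyclic := by
    -- By `trans_free`, a free edge after a compelled one is absorbed, so a path is either free with
    -- `f` decreasing or becomes a free path followed by compelled edges. In a cycle of the second
    -- kind the last compelled edge can be moved to end at `c`, giving a cycle in `G`.
    have key : ∀ {a b : V}, Relation.TransGen
        (fun a b => G.Compelled a b ∨ (G.Free a b ∧ f b < f a)) a b →
        (Relation.ReflTransGen G.Free a b ∧ f b < f a) ∨
          ∃ c, Relation.ReflTransGen G.Free a c ∧ Relation.TransGen G.Compelled c b := by
      intro a b h
      induction h with
      | single h =>
        rcases h with h | h
        exacts [Or.inr ⟨a, .refl, .single h⟩, Or.inl ⟨.single h.1, h.2⟩]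
      | tail _ h ih =>
        rcases ih with ⟨i₁, i₂⟩ | ⟨c, i₁, i₂⟩
        · rcases h with h | h
          exacts [Or.inr ⟨_, i₁, .single h⟩, Or.inl ⟨i₁.tail h.1, h.2.trans i₂⟩]
        · rcases h with h | h
          · exact Or.inr ⟨c, i₁, i₂.tail h⟩
          · obtain ⟨d, hd, e⟩ := Relation.TransGen.tail'_iff.1 i₂
            exact Or.inr ⟨c, i₁, .tail' hd (e.trans_free h.1)⟩
    intro v hv
    rcases key hv with ⟨-, h⟩ | ⟨c, h₁, h₂⟩
    · exact h.false
    · have : Relation.TransGen G.Compelled c c := by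
        obtain ⟨d, hd, e⟩ := Relation.TransGen.tail'_iff.1 h₂
        refine .tail' hd ?_
        clear hd h₂ hv
        induction h₁ with
        | refl => exact e
        | tail _ h ih => exact ih.trans_free h
      exact G.acyclic c (Relation.TransGen.mono (fun _ _ => Compelled.edge) c c this)

/-- Every vertex has an orientation with the same pattern in which all its free edges point away
from it. -/
theorem exists_samePattern_root [Finite V] (G : DAG V) (x : V) :
    ∃ H, G.SamePattern H ∧ ∀ c, G.Free x c → H.Edge x c := by
  have hp : ∀ a b c, G.Free c a → G.Free c b → G.Edge a c → G.Edge b c → a ≠ b → G.Free a b := by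
    intro a b c ha hb ea eb hab
    have hadj : G.Adjacent a b := by
      by_contra hn
      exact ha.2.2 (.vStructure ⟨ea, eb, hab, hn⟩)
    exact ⟨hadj, fun h => ha.2.2 (h.trans_free hb.symm), fun h => hb.2.2 (h.trans_free ha.symm)⟩
  obtain ⟨f, hf, hx, hfp⟩ :=
    G.exists_perfect_ranking (fun _ _ => Free.symm) (fun _ _ h => h.1) hp x
  refine ⟨G.orient f, ?_, fun c hc => Or.inr ⟨hc, hx c hc.ne.symm⟩⟩
  have adj : ∀ a b, G.Adjacent a b ↔ (G.orient f).Adjacent a b := by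
    intro a b
    constructor
    · intro h
      by_cases h₁ : G.Compelled a b
      · exact Or.inl (Or.inl h₁)
      by_cases h₂ : G.Compelled b a
      · exact Or.inr (Or.inl h₂)
      have hfr : G.Free a b := ⟨h, h₁, h₂⟩
      rcases lt_or_gt_of_ne (hf.ne hfr.ne) with h | h
      exacts [Or.inr (Or.inr ⟨hfr.symm, h⟩), Or.inl (Or.inr ⟨hfr, h⟩)]
    · rintro ((h | h) | (h | h))
      exacts [Or.inl h.edge, h.1.1, Or.inr h.edge, h.1.1.symm]
  refine ⟨adj, fun a v b => ⟨fun h => ?_, fun ⟨h₁, h₂, hne, hn⟩ => ?_⟩⟩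
  · exact ⟨Or.inl (.vStructure h), Or.inl (.vStructure h.symm), h.2.2.1,
      fun h' => h.2.2.2 ((adj _ _).2 h')⟩
  · rw [← adj] at hn
    -- An unshielded collider consists of two compelled edges: a compelled and a free edge would be
    -- shielded by `trans_free`, two free ones by the ranking.
    rcases h₁ with h₁ | h₁ <;> rcases h₂ with h₂ | h₂
    · exact ⟨h₁.edge, h₂.edge, hne, hn⟩
    · exact (hn (Or.inl (h₁.trans_free h₂.1.symm).edge)).elim
    · exact (hn (Or.inr (h₂.trans_free h₁.1.symm).edge)).elim
    · exact (hn (hfp a b v h₁.1.symm h₂.1.symm h₁.2 h₂.2 hne).1).elim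

/-- Completeness of the rules: an edge `a → b` that is not compelled is free, so the orientation
rooted at `b` reverses it. -/
theorem compelled_iff [Finite V] {a b : V} :
    G.Compelled a b ↔ ∀ H, G.MarkovEquiv H → H.Edge a b := by
  refine ⟨fun h H hH => h.edge_of_samePattern hH.samePattern, fun h => ?_⟩
  by_contra hab
  have hG := h G (.refl G)
  obtain ⟨H, hH, hr⟩ := G.exists_samePattern_root b
  exact (h H hH.markovEquiv).asymm
    (hr a ⟨Or.inr hG, fun h' => hG.asymm h'.edge, hab⟩)

end DAG

/-! ### Chain components and explicit causes -/

namespace PDGraph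

variable {S : PDGraph V} {G H : DAG V}

theorem Represents.of_markovEquiv (h : S.Represents G) (hGH : G.MarkovEquiv H) :
    S.Represents H :=
  ⟨fun a b => (h.1 a b).trans (hGH.samePattern.1 a b), fun a b => (h.2 a b).trans
    ⟨fun h' K hK => h' K (hGH.trans hK), fun h' K hK => h' K (hGH.symm.trans hK)⟩⟩

theorem Represents.edge (h : S.Represents G) {a b : V} (hab : S.directed.Adj a b) : G.Edge a b :=
  (h.2 a b).1 hab G (.refl G)

theorem Represents.undirected_or_directed (h : S.Represents G) {a b : V} (hab : G.Edge a b) :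
    S.undirected.Adj a b ∨ S.directed.Adj a b := by
  rcases (h.1 a b).2 (Or.inl hab) with h' | h' | h'
  exacts [Or.inr h', (hab.asymm (h.edge h')).elim, Or.inl h']

theorem SameChainComponent.symm {x y : V} (h : S.SameChainComponent x y) :
    S.SameChainComponent y x := SimpleGraph.Reachable.symm h

theorem SameChainComponent.trans {x y z : V} (h : S.SameChainComponent x y)
    (h' : S.SameChainComponent y z) : S.SameChainComponent x z := SimpleGraph.Reachable.trans h h'

theorem isExplicitCause_of_transGen {x y : V} (h : Relation.TransGen S.directed.Adj x y) :
    S.IsExplicitCause x y := by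
  obtain ⟨l, hl, hy⟩ := List.exists_isChain_cons_of_relationReflTransGen h.to_reflTransGen
  refine ⟨x :: l, fun G hG => ⟨?_, ?_, hl.imp fun _ _ => hG.edge, rfl, ?_⟩⟩
  · rintro rfl
    exact G.acyclic x (Relation.TransGen.mono (fun _ _ => hG.edge) x x h)
  · have h₁ : (x :: l).IsChain (Relation.TransGen G.Edge) := hl.imp fun _ _ h => .single (hG.edge h)
    refine h₁.pairwise.imp fun h => ?_
    rintro rfl
    exact G.acyclic _ h
  · rw [List.getLast?_eq_some_getLast (List.cons_ne_nil _ _), hy]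

theorem IsExplicitCause.isAncestor {x y : V} (h : S.IsExplicitCause x y) (hG : S.Represents G) :
    G.IsAncestor x y := by
  obtain ⟨p, hp⟩ := h
  obtain ⟨-, -, h₁, h₂, h₃⟩ := hp G hG
  match p with
  | [] => simp at h₂
  | z :: l =>
    simp at h₂
    subst h₂
    exact List.relationReflTransGen_of_exists_isChain_cons l h₁
      (Option.some.inj ((List.getLast?_eq_some_getLast _).symm.trans h₃))

variable [Finite V]

theorem Represents.directed_iff (h : S.Represents G) {a b : V} :
    S.directed.Adj a b ↔ G.Compelled a b := (h.2 a b).trans DAG.compelled_iff.symm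

theorem Represents.undirected_iff (h : S.Represents G) {a b : V} :
    S.undirected.Adj a b ↔ G.Free a b := by
  simp only [DAG.Free, ← h.directed_iff, ← h.1 a b, Adjacent]
  have h₁ := S.not_both a b
  have h₂ := fun h' : S.undirected.Adj a b => S.not_both b a (SimpleGraph.Adj.symm h')
  tauto

theorem Represents.directed_of_sameChainComponent (h : S.Represents G) {a b c : V}
    (hab : S.directed.Adj a b) (hbc : S.SameChainComponent b c) : S.directed.Adj a c := by
  rw [SameChainComponent, SimpleGraph.reachable_iff_reflTransGen] at hbc
  induction hbc with
  | refl => exact hab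
  | tail _ e ih =>
    rw [h.directed_iff] at ih ⊢
    exact ih.trans_free (h.undirected_iff.1 e)

theorem Represents.exists_root (h : S.Represents G) (x : V) :
    ∃ H, S.Represents H ∧ ∀ c, S.undirected.Adj x c → H.Edge x c := by
  obtain ⟨H, hH, hx⟩ := G.exists_samePattern_root x
  exact ⟨H, h.of_markovEquiv hH.markovEquiv, fun c hc => hx c (h.undirected_iff.1 hc)⟩

theorem Represents.isAncestor_of_root (h : S.Represents G) {x z : V}
    (hx : ∀ c, S.undirected.Adj x c → G.Edge x c) (hz : S.SameChainComponent x z) :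
    G.IsAncestor x z := by
  let r : V → V → Prop := fun a b => S.undirected.Adj a b ∧ G.Edge a b
  -- If `d → c` points against the path `x, …, e, c`, then `e` and `d` are adjacent for lack of a
  -- v-structure, and by a free edge; so `d` is already reached from `e`.
  have key : ∀ c, Relation.ReflTransGen r x c → ∀ d, S.undirected.Adj c d →
      Relation.ReflTransGen r x d := by
    intro c hc
    induction hc with
    | refl => exact fun d hd => .single ⟨hd, hx d hd⟩
    | @tail e c he hec ih =>
      intro d hcd
      have hc := he.tail hec
      rcases (h.1 c d).1 (Or.inr (Or.inr hcd)) with hd | hd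
      · exact hc.tail ⟨hcd, hd⟩
      by_cases hde : e = d
      · exact hde ▸ he
      refine ih d (h.undirected_iff.2 ?_)
      have h₁ := h.undirected_iff.1 hec.1
      have h₂ := h.undirected_iff.1 hcd
      have hadj : G.Adjacent e d := by
        by_contra hn
        exact h₁.2.1 (.vStructure ⟨hec.2, hd, hde, hn⟩)
      exact ⟨hadj, fun h' => h₁.2.1 (h'.trans_free h₂.symm), fun h' => h₂.2.2 (h'.trans_free h₁)⟩
  have : Relation.ReflTransGen r x z := by
    rw [SameChainComponent, SimpleGraph.reachable_iff_reflTransGen] at hz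
    induction hz with
    | refl => exact .refl
    | tail _ e ih => exact key _ ih _ e
  exact Relation.ReflTransGen.mono (fun _ _ h => h.2) x z this

/-- The last edge of a path into the root would be directed in the CPDAG, hence also point at `z`,
closing a cycle. -/
theorem Represents.eq_of_isAncestor_root (h : S.Represents G) {x z : V}
    (hx : ∀ c, S.undirected.Adj x c → G.Edge x c) (hz : S.SameChainComponent x z)
    (ha : G.IsAncestor z x) : z = x := by
  rcases Relation.ReflTransGen.cases_tail ha with h' | ⟨w, hw, e⟩
  · exact h'.symm
  · rcases h.undirected_or_directed e with h' | h'
    · exact (e.asymm (hx w h'.symm)).elim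
    · exact (G.acyclic z (.tail' hw (h.edge (h.directed_of_sameChainComponent h' hz)))).elim

theorem Represents.exists_isExplicitCause (h : S.Represents G) {z y : V}
    (ha : G.IsAncestor z y) (hn : ¬ S.SameChainComponent z y) :
    ∃ c, S.SameChainComponent z c ∧ G.IsAncestor z c ∧ S.IsExplicitCause c y := by
  have : S.SameChainComponent z y ∨ ∃ c, S.SameChainComponent z c ∧ G.IsAncestor z c ∧
      Relation.TransGen S.directed.Adj c y := by
    clear hn
    induction ha with
    | refl => exact Or.inl (.refl z)
    | tail ha e ih =>
      rcases h.undirected_or_directed e with e | e <;> rcases ih with ih | ⟨c, h₁, h₂, h₃⟩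
      · exact Or.inl (ih.trans e.reachable)
      · obtain ⟨d, hd, e'⟩ := Relation.TransGen.tail'_iff.1 h₃
        exact Or.inr ⟨c, h₁, h₂, .tail' hd (h.directed_of_sameChainComponent e' e.reachable)⟩
      · exact Or.inr ⟨_, ih, ha, .single e⟩
      · exact Or.inr ⟨c, h₁, h₂, h₃.tail e⟩
  obtain ⟨c, h₁, h₂, h₃⟩ := this.resolve_left hn
  exact ⟨c, h₁, h₂, isExplicitCause_of_transGen h₃⟩

theorem isPossibleCause_of_unique_isExplicitCause (hS : S.IsCPDAG) {x y z : V}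
    (hxy : ¬ S.SameChainComponent x y) (hx : S.IsExplicitCause x y)
    (hu : ∀ z, S.SameChainComponent x z → S.IsExplicitCause z y → z = x)
    (hz : S.SameChainComponent x z) (hzx : z ≠ x) : S.IsPossibleCause z y := by
  obtain ⟨G, hG⟩ := hS
  have hzy : ¬ S.SameChainComponent z y := fun h => hxy (hz.trans h)
  constructor
  · intro hd
    obtain ⟨H, hH, hr⟩ := hG.exists_root x
    obtain ⟨c, h₁, h₂, h₃⟩ := hH.exists_isExplicitCause (hd H hH).1 hzy
    obtain rfl := hu c (hz.trans h₁) h₃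
    exact hzx (hH.eq_of_isAncestor_root hr hz h₂)
  · intro hd
    obtain ⟨H, hH, hr⟩ := hG.exists_root z
    refine hd H hH ⟨(hH.isAncestor_of_root hr hz.symm).trans (hx.isAncestor hH), ?_⟩
    rintro rfl
    exact hzy (.refl z)

theorem IsImplicitCause.exists_isExplicitCause (hS : S.IsCPDAG) {w y : V}
    (h : S.IsImplicitCause w y) :
    ∃ a b : V, a ≠ b ∧ S.SameChainComponent w a ∧ S.SameChainComponent w b ∧
      S.IsExplicitCause a y ∧ S.IsExplicitCause b y := by
  obtain ⟨hd, hi⟩ := h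
  obtain ⟨G, hG⟩ := id hS
  have hwy : ¬ S.SameChainComponent w y := by
    intro hwy
    obtain ⟨H, hH, hr⟩ := hG.exists_root y
    exact (hd H hH).2 (hH.eq_of_isAncestor_root hr hwy.symm (hd H hH).1)
  obtain ⟨c, h₁, -, h₃⟩ := hG.exists_isExplicitCause (hd G hG).1 hwy
  by_contra! hn
  refine (isPossibleCause_of_unique_isExplicitCause hS (fun h => hwy (h₁.trans h)) h₃
    (fun z hz hzy => ?_) h₁.symm ?_).1 hd
  · by_contra hzc
    exact hn z c hzc (h₁.trans hz) h₁ hzy h₃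
  · rintro rfl
    exact hi h₃

end PDGraph

end CausalGraph

theorem proposition3 {V : Type*} [Finite V] (S : CausalGraph.PDGraph V) (hS : S.IsCPDAG) :
    (∀ x y : V, ¬ S.SameChainComponent x y →
      S.IsExplicitCause x y →
      (∀ z, S.SameChainComponent x z → S.IsExplicitCause z y → z = x) →
      ∀ z, S.SameChainComponent x z → z ≠ x → S.IsPossibleCause z y) ∧
    (∀ w y : V, S.IsImplicitCause w y →
      ∃ a b : V, a ≠ b ∧ S.SameChainComponent w a ∧ S.SameChainComponent w b ∧
        S.IsExplicitCause a y ∧ S.IsExplicitCause b y) :=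
  ⟨fun _ _ hxy hx hu _ hz hzx =>
    CausalGraph.PDGraph.isPossibleCause_of_unique_isExplicitCause hS hxy hx hu hz hzx,
  fun _ _ h => h.exists_isExplicitCause hS⟩
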